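/- Let $V$ be a finite set. A signed digraph $G$ on $V$ is a set of arcs $E\subseteq V\times V\times\{-1,1\}$, where $(j,i,s)\in E$ is an arc from $j$ to $i$ of sign $s$ (loops, and arcs of both signs from one vertex to another, are allowed). A cycle of $G$ is a subgraph consisting of distinct vertices $v_0,\dots,v_n$ ($n\ge 0$) and, for each $k$, exactly one arc from $v_k$ to $v_{k+1}$, indices modulo $n+1$; it is negative if the product of the signs of its arcs is $-1$. Two cycles are the same if they have the same signed arcs. $G$ is strongly connected if for all $j,i\in V$ there is a directed path (possibly of length zero, arcs of any sign) from $j$ to $i$. For $f:\{0,1\}^V\to\{0,1\}^V$, the signed interaction graph $G(f)$ has a positive (negative) arc from $j$ to $i$ if there are $x,y\in\{0,1\}^V$ that differ only in component $j$, with $x_j=0$, $y_j=1$, such that $f_i(y)-f_i(x)$ is positive (negative). The asynchronous graph $\Gamma(f)$ is the digraph on $\{0,1\}^V$ with an arc from $x$ to $y$ if and only if $y$ is obtained from $x$ by flipping a single component $i$ with $f_i(x)\ne x_i$. A trap set is a set $X\subseteq\{0,1\}^V$ that no arc of $\Gamma(f)$ leaves; an attractor is an inclusion-minimal non-empty trap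 set. A subspace is a set of the form $\{x : x_i=c_i \text{ for all } i\in I\}$ with $I\subseteq V$ and $c\in\{0,1\}^I$; a trap space is a subspace that is a trap set. For non-empty $X\subseteq\{0,1\}^V$, let $[X]$ and $\langle X\rangle$ be the smallest subspace and the smallest trap space containing $X$. $\Gamma(f)$ is separating if $[A]\cap[B]=\emptyset$ for all distinct attractors $A,B$, and trapping if it is separating and $[A]=\langle A\rangle$ for every attractor $A$. $G$ is separating (resp. trapping) if $\Gamma(f)$ is separating (resp. trapping) for every $f$ with $G(f)=G$. Theorem. Let $G$ be a signed digraph on a finite set $V$. If $G$ has at most one negative cycle, then $G$ is separating. If $G$ is strongly connected and has at most one negative cycle, then $G$ is trapping. -/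

import Mathlib

/-- A signed digraph with vertex set `V`: a set of arcs, where `(j, i, s)` is an arc
from `j` to `i` of sign `s`. The group `ℤˣ` is the set of signs `{1, -1}`. -/
@[ext]
structure SignedDigraph (V : Type*) where
  arcs : Set (V × V × ℤˣ)

namespace SignedDigraph

variable {V : Type*}

/-- `C` is (the arc set of) a cycle of `G`. A cycle is a subgraph of `G`: it goes through `n + 1`
distinct vertices `v 0, …, v n` in cyclic order (addition in `Fin (n + 1)` is cyclic), with exactly
one arc from `v k` to `v (k + 1)` for each `k`, of some sign `s k`. Loops are the case `n = 0`.
Two cycles are equal if and only if they have the same signed arcs. -/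
def IsCycle (G : SignedDigraph V) (C : Finset (V × V × ℤˣ)) : Prop :=
  (C : Set (V × V × ℤˣ)) ⊆ G.arcs ∧
    ∃ (n : ℕ) (v : Fin (n + 1) → V) (s : Fin (n + 1) → ℤˣ), Function.Injective v ∧
      (C : Set (V × V × ℤˣ)) = Set.range fun k => (v k, v (k + 1), s k)

/-- A negative cycle: the product of the signs of its arcs is `-1`. -/
def IsNegativeCycle (G : SignedDigraph V) (C : Finset (V × V × ℤˣ)) : Prop :=
  G.IsCycle C ∧ ∏ a ∈ C, a.2.2 = -1

def HasAtMostOneNegativeCycle (G : SignedDigraph V) : Prop :=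
  {C | G.IsNegativeCycle C}.Subsingleton

/-- Strong connectedness of the underlying unsigned digraph. -/
def IsStrong (G : SignedDigraph V) : Prop :=
  ∀ j i : V, Relation.ReflTransGen (fun a b => ∃ s : ℤˣ, (a, b, s) ∈ G.arcs) j i

end SignedDigraph

namespace BooleanNetwork

variable {V : Type*}

/-- A subspace of `{0,1}^V`: the set of configurations in which the components in some set `I`
have prescribed values. -/
def IsSubspace (X : Set (V → Bool)) : Prop :=
  ∃ (I : Set V) (c : V → Bool), X = {x | ∀ i ∈ I, x i = c i}

/-- `[X]`, the smallest subspace containing `X` (for non-empty `X`). -/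
def subspaceHull (X : Set (V → Bool)) : Set (V → Bool) :=
  ⋂₀ {Y | IsSubspace Y ∧ X ⊆ Y}

/-- `X` is a trap set of the digraph `Γ` on `{0,1}^V`: no arc of `Γ` leaves `X`. -/
def IsTrapSet (Γ : (V → Bool) → (V → Bool) → Prop) (X : Set (V → Bool)) : Prop :=
  ∀ x ∈ X, ∀ y, Γ x y → y ∈ X

def IsTrapSpace (Γ : (V → Bool) → (V → Bool) → Prop) (X : Set (V → Bool)) : Prop :=
  IsSubspace X ∧ IsTrapSet Γ X

/-- `⟨X⟩`, the smallest trap space of `Γ` containing `X` (for non-empty `X`). -/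
def trapSpaceHull (Γ : (V → Bool) → (V → Bool) → Prop) (X : Set (V → Bool)) : Set (V → Bool) :=
  ⋂₀ {Y | IsTrapSpace Γ Y ∧ X ⊆ Y}

/-- An attractor: an inclusion-minimal non-empty trap set. -/
def IsAttractor (Γ : (V → Bool) → (V → Bool) → Prop) (A : Set (V → Bool)) : Prop :=
  Minimal (fun X => X.Nonempty ∧ IsTrapSet Γ X) A

def IsSeparating (Γ : (V → Bool) → (V → Bool) → Prop) : Prop :=
  ∀ A B, IsAttractor Γ A → IsAttractor Γ B → A ≠ B → subspaceHull A ∩ subspaceHull B = ∅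

def IsTrapping (Γ : (V → Bool) → (V → Bool) → Prop) : Prop :=
  IsSeparating Γ ∧ ∀ A, IsAttractor Γ A → subspaceHull A = trapSpaceHull Γ A

variable [DecidableEq V]

/-- The asynchronous graph `Γ(f)`: there is an arc from `x` to `y` if `y` is obtained from `x` by
flipping a component `i` such that `f x i ≠ x i`. -/
def asyncGraph (f : (V → Bool) → (V → Bool)) (x y : V → Bool) : Prop :=
  ∃ i, f x i ≠ x i ∧ y = Function.update x i (!(x i))

/-- The signed interaction graph `G(f)`: there is an arc from `j` to `i` of sign `1` (resp. `-1`) if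
for some `x` with `x j = 0`, switching component `j` to `1` increases (resp. decreases) `f_i`. -/
def interactionGraph (f : (V → Bool) → (V → Bool)) : SignedDigraph V where
  arcs := {a | ∃ x : V → Bool, x a.1 = false ∧
    ((a.2.2 = 1 ∧ f x a.2.1 = false ∧ f (Function.update x a.1 true) a.2.1 = true) ∨
      (a.2.2 = -1 ∧ f x a.2.1 = true ∧ f (Function.update x a.1 true) a.2.1 = false))}

end BooleanNetwork

namespace SignedDigraph

variable {V : Type*} [DecidableEq V]

/-- `G` is separating if `Γ(f)` is, for every Boolean network `f` whose interaction graph is `G`. -/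
def IsSeparating (G : SignedDigraph V) : Prop :=
  ∀ f : (V → Bool) → (V → Bool), BooleanNetwork.interactionGraph f = G →
    BooleanNetwork.IsSeparating (BooleanNetwork.asyncGraph f)

/-- `G` is trapping if `Γ(f)` is, for every Boolean network `f` whose interaction graph is `G`. -/
def IsTrapping (G : SignedDigraph V) : Prop :=
  ∀ f : (V → Bool) → (V → Bool), BooleanNetwork.interactionGraph f = G →
    BooleanNetwork.IsTrapping (BooleanNetwork.asyncGraph f)

end SignedDigraph

/-! A strongly connected signed digraph without negative cycle is balanced: a potential `ρ` makes
every arc sign the product of its values at the two ends, so the network becomes monotone after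
complementing some components. If there is a unique negative cycle, this remains true after deleting
one suitable arc (`exists_potential_diff_singleton`). The network is then monotone except at the
head of that arc; `T` is this head, or empty.

On a strong part of this kind, an attractor that is constant on `T` and on everything upstream is
frozen (`exists_fixed_on`). An attractor that reaches both extreme values on `T` has a greatest and
a least state on the part. If the hulls of two attractors share a point `w`, the least state of one
lies below `w`, hence below the greatest state of the other, which acts as a barrier; so the two
greatest states coincide.

For separation, strong parts are added in topological order while the attractors are shown to agree
(`AgreeOn.union`). The part processed so far is frozen as long as it contains no negative cycle. In
the end the attractors share a configuration, so they are equal. For trapping there is a single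
strong part: either the attractor is one configuration, or its extreme states control `f` on the
whole hull. -/

namespace SignedDigraph

/-! ### Signed walks and negative closed walks -/

open Set

variable {V : Type*}

/-- There is a walk of sign `e` from `u` to `v` with arcs in `E`. -/
inductive SignedWalk (E : Set (V × V × ℤˣ)) (u : V) : V → ℤˣ → Prop
  | refl : SignedWalk E u u 1
  | tail {v w : V} {e s : ℤˣ} : SignedWalk E u v e → (v, w, s) ∈ E → SignedWalk E u w (e * s)

namespace SignedWalk

variable {E F : Set (V × V × ℤˣ)} {u v w : V} {e s : ℤˣ}

theorem single (h : (u, v, s) ∈ E) : SignedWalk E u v s := by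
  simpa using SignedWalk.refl.tail h

theorem trans {e' : ℤˣ} (h₁ : SignedWalk E u v e) (h₂ : SignedWalk E v w e') :
    SignedWalk E u w (e * e') := by
  induction h₂ with
  | refl => simpa
  | tail _ h ih => rw [← mul_assoc]; exact ih.tail h

theorem head (h₁ : (u, v, s) ∈ E) (h₂ : SignedWalk E v w e) : SignedWalk E u w (s * e) :=
  (single h₁).trans h₂

theorem mono (h : SignedWalk E u v e) (hEF : E ⊆ F) : SignedWalk F u v e := by
  induction h with
  | refl => exact .refl
  | tail _ h ih => exact ih.tail (hEF h)

/-- A walk stays in a set that it cannot leave. -/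
theorem restrict {S : Set V} (h : SignedWalk E u v e) (hu : u ∈ S)
    (hS : ∀ j k s, j ∈ S → (j, k, s) ∈ E → k ∈ S) :
    v ∈ S ∧ SignedWalk {a ∈ E | a.1 ∈ S ∧ a.2.1 ∈ S} u v e := by
  induction h with
  | refl => exact ⟨hu, .refl⟩
  | tail _ h ih => exact ⟨hS _ _ _ ih.1 h, ih.2.tail ⟨h, ih.1, hS _ _ _ ih.1 h⟩⟩

/-- A walk stays in a set that it cannot enter. -/
theorem restrict' {S : Set V} (h : SignedWalk E u v e) (hv : v ∈ S)
    (hS : ∀ j k s, k ∈ S → (j, k, s) ∈ E → j ∈ S) :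
    u ∈ S ∧ SignedWalk {a ∈ E | a.1 ∈ S ∧ a.2.1 ∈ S} u v e := by
  induction h with
  | refl => exact ⟨hv, .refl⟩
  | tail _ h ih =>
    have := ih (hS _ _ _ hv h)
    exact ⟨this.1, this.2.tail ⟨h, hS _ _ _ hv h, hv⟩⟩

/-- A walk from outside of `S` to a vertex in `S` enters `S` through some arc. -/
theorem exists_entry {S : Set V} (h : SignedWalk E u v e) (hu : u ∉ S) (hv : v ∈ S) :
    ∃ j k s e₁ e₂, j ∉ S ∧ k ∈ S ∧ (j, k, s) ∈ E ∧ SignedWalk E u j e₁ ∧ SignedWalk E k v e₂ ∧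
      e = e₁ * s * e₂ := by
  induction h with
  | refl => exact absurd hv hu
  | @tail v w e s hw h ih =>
    by_cases hvS : v ∈ S
    · obtain ⟨j, k, s', e₁, e₂, hj, hk, ha, h₁, h₂, rfl⟩ := ih hvS
      exact ⟨j, k, s', e₁, e₂ * s, hj, hk, ha, h₁, h₂.tail h, by simp [mul_assoc]⟩
    · exact ⟨v, w, s, e, 1, hvS, hv, h, hw, .refl, by simp⟩

theorem exists_seq (h : SignedWalk E u v e) : ∃ (n : ℕ) (x : ℕ → V) (s : ℕ → ℤˣ),
    x 0 = u ∧ x n = v ∧ (∀ k < n, (x k, x (k + 1), s k) ∈ E) ∧ ∏ k ∈ Finset.range n, s k = e := by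
  induction h with
  | refl => exact ⟨0, fun _ => u, fun _ => 1, rfl, rfl, by simp, by simp⟩
  | @tail v w e s' _ ha ih =>
    obtain ⟨n, x, s, h0, hn, hE, hs⟩ := ih
    refine ⟨n + 1, fun k => if k ≤ n then x k else w, fun k => if k < n then s k else s', ?_, ?_,
      ?_, ?_⟩
    · simpa
    · simp
    · intro k hk
      rcases Nat.lt_succ_iff_lt_or_eq.1 hk with h | rfl
      · simpa [h.le, Nat.succ_le_of_lt h, h] using hE k h
      · simpa [hn] using ha
    · rw [Finset.prod_range_succ, Finset.prod_congr rfl fun k hk => if_pos (Finset.mem_range.1 hk),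
        hs]
      simp

end SignedWalk

theorem sign_eq_or (e : ℤˣ) : e = 1 ∨ e = -1 := Int.units_eq_one_or e

/-- An arc set without negative cycle has no negative closed walk. -/
theorem SignedWalk.closed_pos {E : Set (V × V × ℤˣ)}
    (hE : ∀ C, ¬ (SignedDigraph.mk E).IsNegativeCycle C) {v : V} {e : ℤˣ}
    (h : SignedWalk E v v e) : e = 1 := by
  classical
  obtain ⟨n, x, s, h0, hn, hx, hs⟩ := h.exists_seq
  rw [← h0] at hn
  clear h h0 v
  subst hs
  induction n using Nat.strong_induction_on generalizing x s with
  | _ n ih =>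
  by_cases hinj : ∀ p q, p < q → q < n → x p ≠ x q
  · rcases n with _ | n
    · simp
    by_contra hne
    have hneg := (sign_eq_or _).resolve_left hne
    have hinj' : Function.Injective fun k : Fin (n + 1) => x k := by
      intro p q hpq
      by_contra hpq'
      rcases lt_or_gt_of_ne hpq' with h | h
      · exact hinj p q h q.2 hpq
      · exact hinj q p h p.2 hpq.symm
    have hsucc : ∀ k : Fin (n + 1), x ((k + 1 : Fin (n + 1)) : ℕ) = x (k + 1) := by
      intro k
      rcases Fin.eq_castSucc_or_eq_last k with ⟨j, rfl⟩ | rfl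
      · simp
      · simp [hn]
    let arc : Fin (n + 1) → V × V × ℤˣ := fun k => (x k, x ((k + 1 : Fin (n + 1)) : ℕ), s k)
    have harc : Function.Injective arc := fun p q h => hinj' (congrArg Prod.fst h)
    refine hE (Finset.univ.image arc) ⟨⟨?_, n, fun k => x k, fun k => s k, hinj', ?_⟩, ?_⟩
    · intro a ha
      simp only [Finset.coe_image, Finset.coe_univ, image_univ, mem_range] at ha
      obtain ⟨k, rfl⟩ := ha
      simp only [arc, hsucc]
      exact hx k k.2
    · simp [arc]
    · rw [Finset.prod_image fun p _ q _ h => harc h, ← hneg, Finset.prod_range]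
  -- A repeated vertex splits the closed walk into two shorter closed walks, both positive by
  -- induction.
  · push Not at hinj
    obtain ⟨p, q, hpq, hqn, hxpq⟩ := hinj
    have key : ∀ m < n, ∀ y : V, ∀ e : ℤˣ, (∃ (z : ℕ → V) (r : ℕ → ℤˣ), z 0 = y ∧ z m = y ∧
      (∀ k < m, (z k, z (k + 1), r k) ∈ E) ∧ ∏ k ∈ Finset.range m, r k = e) → e = 1 := by
      rintro m hm y e ⟨z, r, h1, h2, h3, rfl⟩
      exact ih m hm z r (h2.trans h1.symm) h3
    have h1 : ∏ k ∈ Finset.Ico p q, s k = 1 := by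
      refine key (q - p) (by omega) (x p) _ ⟨fun k => x (p + k), fun k => s (p + k), rfl, ?_, ?_, ?_⟩
      · simp only [Nat.add_sub_cancel' hpq.le, hxpq]
      · exact fun k hk => hx (p + k) (by omega)
      · rw [Finset.prod_Ico_eq_prod_range]
    -- The walk with the segment from `p` to `q` cut out: an index `k` beyond `p` is read at `k - p
    -- + q`.
    have h2 : (∏ k ∈ Finset.range p, s k) * ∏ k ∈ Finset.Ico q n, s k = 1 := by
      refine key (p + (n - q)) (by omega) (x 0) _ ⟨fun k => if k ≤ p then x k else x (k - p + q),
        fun k => if k < p then s k else s (k - p + q), by simp, ?_, ?_, ?_⟩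
      · have : ¬ p + (n - q) ≤ p := by omega
        simp only [this, if_false, ← hn]
        congr 1; omega
      · intro k hk
        rcases lt_trichotomy k p with h | rfl | h
        · simpa [h, h.le, Nat.succ_le_of_lt h] using hx k (by omega)
        · have := hx q hqn
          simp only [le_refl, if_true, Nat.lt_irrefl, if_false, Nat.sub_self, Nat.zero_add,
            show ¬ k + 1 ≤ k by omega, hxpq, show k + 1 - k + q = q + 1 by omega]
          exact this
        · have := hx (k - p + q) (by omega)
          simp only [show ¬ k ≤ p by omega, show ¬ k < p by omega, show ¬ k + 1 ≤ p by omega, if_false,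
            show k + 1 - p + q = k - p + q + 1 by omega]
          exact this
      · rw [Finset.prod_range_add]
        congr 1
        · exact Finset.prod_congr rfl fun k hk => if_pos (Finset.mem_range.1 hk)
        · rw [Finset.prod_Ico_eq_prod_range]
          refine Finset.prod_congr rfl fun k _ => ?_
          rw [if_neg (by omega)]
          congr 1; omega
    rw [← Finset.prod_range_mul_prod_Ico s hqn.le, ← Finset.prod_range_mul_prod_Ico s hpq.le, h1,
      mul_one, h2]

/-! ### Potentials, with at most one exceptional arc -/

/-- The sign of each arc in `E` is the product of the values of `ρ` at its ends. -/
def IsPotential (E : Set (V × V × ℤˣ)) (ρ : V → ℤˣ) : Prop :=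
  ∀ j k s, (j, k, s) ∈ E → s = ρ j * ρ k

open Classical in
/-- The sign of the walks from `u` to `v`. -/
noncomputable def walkSign (E : Set (V × V × ℤˣ)) (u v : V) : ℤˣ :=
  -- The value is `-1` if there is no walk, and `1` if there are walks of both signs.
  if SignedWalk E u v 1 then 1 else -1

theorem walkSign_eq {E : Set (V × V × ℤˣ)} {u v : V} {e : ℤˣ} (h : SignedWalk E u v e)
    (hu : ¬ (SignedWalk E u v 1 ∧ SignedWalk E u v (-1))) : walkSign E u v = e := by
  rcases sign_eq_or e with rfl | rfl
  · exact if_pos h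
  · exact if_neg fun h' => hu ⟨h', h⟩

theorem walkSign_spec {E : Set (V × V × ℤˣ)} {u v : V} {e : ℤˣ} (h : SignedWalk E u v e) :
    SignedWalk E u v (walkSign E u v) := by
  unfold walkSign
  split_ifs with h1
  · exact h1
  · rcases sign_eq_or e with rfl | rfl
    · exact absurd h h1
    · exact h

theorem sign_mul_self (e : ℤˣ) : e * e = 1 := Int.units_mul_self e

theorem eq_mul_of_mul_eq_one {a b c : ℤˣ} (h : a * b * c = 1) : b = a * c := by
  rcases sign_eq_or a with rfl | rfl <;> rcases sign_eq_or b with rfl | rfl <;>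
    rcases sign_eq_or c with rfl | rfl <;> revert h <;> decide

/-- The potential is the sign of the walks from a root `r`. It is consistent along an arc because
both ways to the head of the arc close up, through the same return walk, to positive closed walks.
-/
theorem exists_potential_of_strong {E : Set (V × V × ℤˣ)} {K : Set V}
    (hEK : ∀ j k s, (j, k, s) ∈ E → j ∈ K ∧ k ∈ K)
    (hK : ∀ u ∈ K, ∀ v ∈ K, ∃ e, SignedWalk E u v e)
    (hE : ∀ C, ¬ (SignedDigraph.mk E).IsNegativeCycle C) : ∃ ρ, IsPotential E ρ := by
  rcases K.eq_empty_or_nonempty with rfl | ⟨r, hr⟩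
  · exact ⟨fun _ => 1, fun j k s h => absurd (hEK j k s h).1 (Set.notMem_empty j)⟩
  refine ⟨walkSign E r, fun j k s h => ?_⟩
  obtain ⟨hj, hk⟩ := hEK j k s h
  obtain ⟨e, he⟩ := hK r hr j hj
  obtain ⟨e', he'⟩ := hK k hk r hr
  have h₁ : walkSign E r j * s * e' = 1 := ((walkSign_spec he).tail h |>.trans he').closed_pos hE
  have h₂ : walkSign E r k * e' = 1 := ((walkSign_spec (he.tail h)).trans he').closed_pos hE
  have h₃ : walkSign E r k = e' := by
    rw [← mul_one (walkSign E r k), ← sign_mul_self e', ← mul_assoc, h₂, one_mul]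
  rw [h₃]
  exact eq_mul_of_mul_eq_one h₁

/-- Let `E` be a strongly connected arc set, and let `C` be the arc set of a closed walk through
the arc `(p, r, σ)`. If deleting any arc of `C` destroys all negative closed walks, then all arcs
but one agree with some potential. -/
theorem exists_potential_diff_singleton {E : Set (V × V × ℤˣ)} {K : Set V}
    (hEK : ∀ j k s, (j, k, s) ∈ E → j ∈ K ∧ k ∈ K)
    (hK : ∀ u ∈ K, ∀ v ∈ K, ∃ e, SignedWalk E u v e)
    {C : Set (V × V × ℤˣ)} (hCE : C ⊆ E) {p r : V} {σ : ℤˣ} (haC : (p, r, σ) ∈ C)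
    (hpos : ∀ b ∈ C, ∀ {v e}, SignedWalk (E \ {b}) v v e → e = 1)
    (hcross : ∀ S : Set V, r ∉ S → p ∈ S → ∃ j k s, (j, k, s) ∈ C ∧ j ∉ S ∧ k ∈ S) :
    ∃ b ∈ E, ∃ ρ, IsPotential (E \ {b}) ρ := by
  have haE : (p, r, σ) ∈ E := hCE haC
  obtain ⟨E', hE'⟩ : ∃ E', E' = E \ {(p, r, σ)} := ⟨_, rfl⟩
  have hmem : ∀ {x}, x ∈ E' ↔ x ∈ E ∧ x ≠ (p, r, σ) := by simp [hE']
  have hrK : r ∈ K := (hEK _ _ _ haE).2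
  have hpK : p ∈ K := (hEK _ _ _ haE).1
  have from_r : ∀ v ∈ K, ∃ e, SignedWalk E' r v e := by
    intro v hv
    obtain ⟨e, he⟩ := hK r hrK v hv
    clear hv
    induction he with
    | refl => exact ⟨1, .refl⟩
    | @tail v w e s _ h ih =>
      obtain ⟨e', h'⟩ := ih
      by_cases hs : (v, w, s) = (p, r, σ)
      · cases hs; exact ⟨1, .refl⟩
      · exact ⟨_, h'.tail (hmem.2 ⟨h, hs⟩)⟩
  have to_p : ∀ v ∈ K, ∃ e, SignedWalk E' v p e := by
    intro v hv
    obtain ⟨e, he⟩ := hK v hv p hpK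
    clear hv
    have : ∀ w e, SignedWalk E v w e → (∃ e, SignedWalk E' v p e) ∨ SignedWalk E' v w e := by
      intro w e h
      induction h with
      | refl => exact .inr .refl
      | @tail u w e s _ h ih =>
        rcases ih with ih | ih
        · exact .inl ih
        · by_cases hs : (u, w, s) = (p, r, σ)
          · cases hs; exact .inl ⟨_, ih⟩
          · exact .inr (ih.tail (hmem.2 ⟨h, hs⟩))
    rcases this _ _ he with h | h
    · exact h
    · exact ⟨e, h⟩
  have hpos' : ∀ {v e}, SignedWalk E' v v e → e = 1 := fun h => hpos _ haC (hE' ▸ h)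
  -- `S` is where the sign of walks from `r` is ambiguous. No arc of `E'` leaves it.
  set S : Set V := {v | SignedWalk E' r v 1 ∧ SignedWalk E' r v (-1)} with hSdef
  have hS : ∀ j k s, j ∈ S → (j, k, s) ∈ E' → k ∈ S := by
    rintro j k s ⟨h₁, h₂⟩ h
    have h₁' := h₁.tail h
    have h₂' := h₂.tail h
    rcases sign_eq_or s with rfl | rfl
    · exact ⟨by simpa using h₁', by simpa using h₂'⟩
    · exact ⟨by simpa using h₂', by simpa using h₁'⟩
  have hSc : ∀ j k s, k ∈ Sᶜ → (j, k, s) ∈ E' → j ∈ Sᶜ := fun j k s hk h hj => hk (hS j k s hj h)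
  have hrS : r ∉ S := fun h => absurd (hpos' h.2) (by decide)
  by_cases hSe : S = ∅
  · refine ⟨_, haE, walkSign E' r, fun j k s h => ?_⟩
    rw [← hE'] at h
    obtain ⟨e, he⟩ := from_r j (hEK _ _ _ (hmem.1 h).1).1
    have hn : ∀ v, ¬ (SignedWalk E' r v 1 ∧ SignedWalk E' r v (-1)) := fun v hv => by
      have : v ∈ S := hv
      simp [hSe] at this
    rw [walkSign_eq he (hn _), walkSign_eq (he.tail h) (hn _), ← mul_assoc, sign_mul_self, one_mul]
  -- Some vertex of `S` reaches `p` within `E'`, and such a walk cannot leave `S`.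
  have hpS : p ∈ S := by
    obtain ⟨v, hv⟩ := Set.nonempty_iff_ne_empty.2 hSe
    have hvK : v ∈ K := by
      obtain ⟨_, w, _, _, _, -, rfl, h, -⟩ :=
        hv.2.exists_entry (S := {v}) (fun h => hrS (h ▸ hv)) rfl
      exact (hEK _ _ _ (hmem.1 h).1).2
    obtain ⟨e, he⟩ := to_p v hvK
    exact (he.restrict hv hS).1
  -- The arc through which `C` enters `S` will be the exceptional arc, in place of `(p, r, σ)`.
  obtain ⟨b₁, b₂, sb, hbC, hb₁, hb₂⟩ := hcross S hrS hpS
  have hbE : (b₁, b₂, sb) ∈ E := hCE hbC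
  have hba : (b₁, b₂, sb) ≠ (p, r, σ) := fun h => hb₁ ((Prod.mk.inj h).1 ▸ hpS)
  have haEb : (p, r, σ) ∈ E \ {(b₁, b₂, sb)} := ⟨haE, fun h => hba h.symm⟩
  -- Since `E'` never leaves `S`, walks ending outside `S` stay outside and walks starting in `S`
  -- stay inside. Neither kind uses the crossing arc `b`.
  have low : ∀ {v e}, SignedWalk E' r v e → v ∉ S → SignedWalk (E \ {(b₁, b₂, sb)}) r v e := by
    intro v e h hv
    refine (h.restrict' (S := Sᶜ) hv hSc).2.mono ?_
    rintro x ⟨hx, -, h2⟩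
    refine ⟨(hmem.1 hx).1, fun h => ?_⟩
    rw [mem_singleton_iff] at h
    subst h
    exact h2 hb₂
  have high : ∀ {v w e}, SignedWalk E' v w e → v ∈ S → SignedWalk (E \ {(b₁, b₂, sb)}) v w e := by
    intro v w e h hv
    refine (h.restrict hv hS).2.mono ?_
    rintro x ⟨hx, h1, -⟩
    refine ⟨(hmem.1 hx).1, fun h => ?_⟩
    rw [mem_singleton_iff] at h
    subst h
    exact hb₁ h1
  -- closed walks that enter `S` through an arc other than `b`
  have entry : ∀ {j k s e₁ e₂}, j ∉ S → k ∈ S → (j, k, s) ∈ E' → (j, k, s) ≠ (b₁, b₂, sb) →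
      SignedWalk E' r j e₁ → SignedWalk E' k p e₂ → e₁ * s * e₂ * σ = 1 := by
    intro j k s e₁ e₂ hj hk h hne h₁ h₂
    exact hpos _ hbC ((((low h₁ hj).tail ⟨(hmem.1 h).1, hne⟩).trans (high h₂ hk)).tail haEb)
  have entry_eq : ∀ {j k s}, j ∉ S → k ∈ S → (j, k, s) ∈ E' →
      SignedWalk E' k p 1 → SignedWalk E' k p (-1) → (j, k, s) = (b₁, b₂, sb) := by
    intro j k s hj hk h h₁ h₂
    by_contra hne
    obtain ⟨e, he⟩ := from_r j (hEK _ _ _ (hmem.1 h).1).1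
    have h₁' := entry hj hk h hne he h₁
    have h₂' := entry hj hk h hne he h₂
    rw [mul_one] at h₁'
    simp [h₁'] at h₂'
  have both_of : ∀ {u v e}, SignedWalk E' u v e → SignedWalk E' v p 1 → SignedWalk E' v p (-1) →
      SignedWalk E' u p 1 ∧ SignedWalk E' u p (-1) := by
    intro u v e h h₁ h₂
    have h₁' := h.trans h₁
    have h₂' := h.trans h₂
    rcases sign_eq_or e with rfl | rfl
    · exact ⟨by simpa using h₁', by simpa using h₂'⟩
    · exact ⟨by simpa using h₂', by simpa using h₁'⟩
  -- Inside `S` the sign of walks to `p` is unambiguous. Otherwise `b` would be the only way from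
  -- `r` to `b₂`, which would force a single sign for the walks from `r` to `b₂ ∈ S`.
  have hτ : ∀ k ∈ S, ¬ (SignedWalk E' k p 1 ∧ SignedWalk E' k p (-1)) := by
    rintro k hk ⟨h₁, h₂⟩
    -- the head of `b` has walks of both signs to `p`
    obtain ⟨j₀, k₀, s₀, e₁, e₂, hj₀, hk₀, hs₀, -, hk₀', -⟩ := hk.1.exists_entry hrS hk
    have hk₀p := both_of hk₀' h₁ h₂
    have h₀ := entry_eq hj₀ hk₀ hs₀ hk₀p.1 hk₀p.2
    cases h₀
    have fixed : ∀ {e}, SignedWalk E' r b₂ e → e = walkSign E' r b₁ * sb := by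
      intro e he
      obtain ⟨j, k', s', e₁, e₂, hj, hk', hs', h₁', h₂', rfl⟩ := he.exists_entry hrS hb₂
      have hp' := both_of h₂' hk₀p.1 hk₀p.2
      have := entry_eq hj hk' hs' hp'.1 hp'.2
      cases this
      rw [hpos' h₂', walkSign_eq h₁' hj, mul_one]
    have := (fixed hb₂.1).trans (fixed hb₂.2).symm
    exact absurd this (by decide)
  classical
  -- Outside `S` signs are measured from `r`, inside `S` towards `p`; the factor `σ` fits the two
  -- together along `(p, r, σ)`.
  refine ⟨_, hbE, fun v => if v ∈ S then σ * walkSign E' v p else walkSign E' r v,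
    fun j k s h => ?_⟩
  obtain ⟨hjK, hkK⟩ := hEK _ _ _ h.1
  by_cases hs : (j, k, s) = (p, r, σ)
  · cases hs
    have h1 : walkSign E' p p = 1 := walkSign_eq .refl (hτ p hpS)
    have h2 : walkSign E' r r = 1 := walkSign_eq .refl hrS
    simp [hpS, hrS, h1, h2]
  have hE'' : (j, k, s) ∈ E' := hmem.2 ⟨h.1, hs⟩
  obtain ⟨e₁, h₁⟩ := from_r j hjK
  obtain ⟨e₂, h₂⟩ := to_p k hkK
  by_cases hj : j ∈ S
  · have hk := hS _ _ _ hj hE''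
    simp only [hj, hk, if_true]
    rw [walkSign_eq h₂ (hτ k hk), walkSign_eq (h₂.head hE'') (hτ j hj)]
    rcases sign_eq_or e₂ with rfl | rfl <;> rcases sign_eq_or σ with h | h <;> rw [h] <;> simp
  · by_cases hk : k ∈ S
    · simp only [hj, hk, if_true, if_false]
      have := entry hj hk hE'' h.2 h₁ h₂
      rw [walkSign_eq h₂ (hτ k hk), walkSign_eq h₁ hj, mul_comm σ]
      exact eq_mul_of_mul_eq_one (by rw [← mul_assoc]; exact this)
    · simp only [hj, hk, if_false]
      rw [walkSign_eq h₁ hj, walkSign_eq (h₁.tail hE'') hk, ← mul_assoc, sign_mul_self, one_mul]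

/-- In a strongly connected signed digraph with a unique negative cycle, all arcs but one agree
with some potential. -/
theorem exists_potential_diff_singleton_of_unique {E : Set (V × V × ℤˣ)} {K : Set V}
    (hEK : ∀ j k s, (j, k, s) ∈ E → j ∈ K ∧ k ∈ K)
    (hK : ∀ u ∈ K, ∀ v ∈ K, ∃ e, SignedWalk E u v e)
    {C : Finset (V × V × ℤˣ)} (hC : (SignedDigraph.mk E).IsNegativeCycle C)
    (huniq : ∀ D, (SignedDigraph.mk E).IsNegativeCycle D → D = C) :
    ∃ b ∈ E, ∃ ρ, IsPotential (E \ {b}) ρ := by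
  obtain ⟨⟨hCE, n, c, s, hc, hCr⟩, -⟩ := hC
  have harc : ∀ k, (c k, c (k + 1), s k) ∈ (C : Set (V × V × ℤˣ)) := fun k => by
    rw [hCr]; exact ⟨k, rfl⟩
  have hlast := harc (Fin.last n)
  rw [Fin.last_add_one] at hlast
  refine exists_potential_diff_singleton hEK hK hCE hlast (fun b hb v e h => ?_)
    fun S h0 hn => ?_
  · refine h.closed_pos fun D hD => ?_
    have := huniq D ⟨⟨hD.1.1.trans Set.sdiff_subset, hD.1.2⟩, hD.2⟩
    subst this
    exact (hD.1.1 hb).2 rfl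
  · by_contra hcon
    push Not at hcon
    have : ∀ k : Fin (n + 1), c k ∉ S := by
      intro k
      induction k using Fin.induction with
      | zero => exact h0
      | succ k ih =>
        have := hcon _ _ _ (harc k.castSucc) ih
        rwa [Fin.coeSucc_eq_succ] at this
    exact this _ hn

end SignedDigraph

/-! ### Attractors of networks that are monotone on a part -/

namespace BooleanNetwork

open Set

variable {V : Type*}

open Classical in
/-- The configuration that agrees with `q` on `P` and with `x` elsewhere. -/
noncomputable def glue (P : Set V) (q x : V → Bool) : V → Bool := P.piecewise q x

open Classical in
theorem glue_of_mem {P : Set V} {q x : V → Bool} {k : V} (h : k ∈ P) : glue P q x k = q k :=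
  Set.piecewise_eq_of_mem _ _ _ h

open Classical in
theorem glue_of_notMem {P : Set V} {q x : V → Bool} {k : V} (h : k ∉ P) : glue P q x k = x k :=
  Set.piecewise_eq_of_notMem _ _ _ h

theorem glue_eq_right {P : Set V} {q x : V → Bool} (h : EqOn q x P) : glue P q x = x := by
  funext k
  by_cases hk : k ∈ P
  · rw [glue_of_mem hk, h hk]
  · rw [glue_of_notMem hk]

theorem glue_congr_left {P : Set V} {q q' x : V → Bool} (h : EqOn q q' P) :
    glue P q x = glue P q' x := by
  funext k
  by_cases hk : k ∈ P
  · rw [glue_of_mem hk, glue_of_mem hk, h hk]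
  · rw [glue_of_notMem hk, glue_of_notMem hk]

/-- The order on configurations restricted to `K` in which `t k` is the top value of
component `k`. -/
def Below (t : V → Bool) (K : Set V) (x y : V → Bool) : Prop :=
  ∀ k ∈ K, x k = t k → y k = t k

theorem Below.trans {t : V → Bool} {K : Set V} {x y z : V → Bool} (h₁ : Below t K x y)
    (h₂ : Below t K y z) : Below t K x z := fun k hk h => h₂ k hk (h₁ k hk h)

theorem below_refl (t : V → Bool) (K : Set V) (x : V → Bool) : Below t K x x :=
  fun _ _ h => h

/-- Complementing `t` reverses the order, so results about greatest states also give least states.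
-/
theorem Below.flip {t : V → Bool} {K : Set V} {x y : V → Bool}
    (h : Below (fun k => !t k) K x y) : Below t K y x := by
  intro k hk hy
  by_contra hx
  have := h k hk (by cases hh : x k <;> cases ht : t k <;> simp_all)
  simp_all

theorem Below.antisymm {t : V → Bool} {K : Set V} {x y : V → Bool} (h₁ : Below t K x y)
    (h₂ : Below t K y x) : EqOn x y K := by
  intro k hk
  have a := h₁ k hk
  have b := h₂ k hk
  revert a b
  cases x k <;> cases y k <;> cases t k <;> simp

/-- The number of components of `K` at their top value. -/
noncomputable def height (t : V → Bool) (K : Set V) (x : V → Bool) : ℕ :=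
  {k | k ∈ K ∧ x k = t k}.ncard

theorem height_lt [Finite V] {t : V → Bool} {K : Set V} {x y : V → Bool} {k : V}
    (h : Below t K x y) (hk : k ∈ K) (hx : x k ≠ t k) (hy : y k = t k) :
    height t K x < height t K y := by
  apply Set.ncard_lt_ncard _ (Set.toFinite _)
  exact ⟨fun j hj => ⟨hj.1, h j hj.1 hj.2⟩, fun hs => hx (hs ⟨hk, hy⟩).2⟩

/-- `f k` is increasing in the components in `K` for `k ∈ K \ T`, when the components in `P` are
fixed. In particular it depends only on the components in `P ∪ K`. -/
def MonoOff (f : (V → Bool) → (V → Bool)) (t : V → Bool) (P K T : Set V) : Prop :=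
  ∀ k ∈ K, k ∉ T → ∀ x y, EqOn x y P → Below t K x y → f x k = t k → f y k = t k

/-- For every `P`-part that occurs in `A`, no component in `K \ T` of `c` can move up. -/
def UpClosed (f : (V → Bool) → (V → Bool)) (t : V → Bool) (A : Set (V → Bool)) (P K T : Set V)
    (c : V → Bool) : Prop :=
  ∀ q ∈ A, ∀ k ∈ K, k ∉ T → f (glue P q c) k = t k → c k = t k

/-- The components in `P` depend only on components in `P`. -/
def Autonomous (f : (V → Bool) → (V → Bool)) (P : Set V) : Prop :=
  ∀ k ∈ P, ∀ x y, EqOn x y P → f x k = f y k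

theorem not_eq_of_ne_top {a b : Bool} (h : a ≠ b) : (!a) = b := by
  cases a <;> cases b <;> simp_all

variable {f : (V → Bool) → (V → Bool)} {A B : Set (V → Bool)}
  {P K T : Set V} {t : V → Bool}

theorem IsAttractor.eq_of_trap {X : Set (V → Bool)} {Γ : (V → Bool) → (V → Bool) → Prop}
    (hA : IsAttractor Γ A) (hX : IsTrapSet Γ X) {x : V → Bool} (hxA : x ∈ A) (hxX : x ∈ X) :
    A ⊆ X := by
  have : A ⊆ A ∩ X := hA.2 ⟨⟨x, hxA, hxX⟩, fun y hy z hz => ⟨hA.1.2 y hy.1 z hz, hX y hy.2 z hz⟩⟩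
    Set.inter_subset_left
  exact fun y hy => (this hy).2

theorem IsAttractor.eq_of_mem {Γ : (V → Bool) → (V → Bool) → Prop}
    (hA : IsAttractor Γ A) (hB : IsAttractor Γ B) {x : V → Bool} (hxA : x ∈ A) (hxB : x ∈ B) :
    A = B :=
  (hA.eq_of_trap hB.1.2 hxA hxB).antisymm (hB.eq_of_trap hA.1.2 hxB hxA)

theorem IsAttractor.reach {Γ : (V → Bool) → (V → Bool) → Prop}
    (hA : IsAttractor Γ A) {x y : V → Bool} (hx : x ∈ A) (hy : y ∈ A) :
    Relation.ReflTransGen Γ x y :=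
  hA.eq_of_trap (X := {y | Relation.ReflTransGen Γ x y}) (fun _ h _ h' => h.tail h') hx
    Relation.ReflTransGen.refl hy

theorem MonoOff.congr (hm : MonoOff f t P K T) {k : V} (hk : k ∈ K) (hkT : k ∉ T)
    {x y : V → Bool} (hP : EqOn x y P) (hK : EqOn x y K) : f x k = f y k := by
  have h₁ := hm k hk hkT x y hP fun j hj h => by rw [← hK hj, h]
  have h₂ := hm k hk hkT y x hP.symm fun j hj h => by rw [hK hj, h]
  revert h₁ h₂
  cases f x k <;> cases f y k <;> cases t k <;> simp

theorem mem_subspaceHull_apply {w : V → Bool} (hw : w ∈ subspaceHull A) {k : V} {c : Bool}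
    (h : ∀ a ∈ A, a k = c) : w k = c := by
  have := Set.mem_sInter.1 hw {x | x k = c} ⟨⟨{k}, fun _ => c, by ext; simp⟩, h⟩
  exact this

/-- A component where `u` is not at its top is never at its top on `A`, so it is constant on the
hull. -/
theorem mem_subspaceHull_below {w u : V → Bool} (hw : w ∈ subspaceHull A)
    (h : ∀ a ∈ A, Below t K a u) : Below t K w u := by
  intro k hk hwk
  by_contra hu
  have : w k = !t k := mem_subspaceHull_apply hw fun a ha => by
    have := mt (h a ha k hk) hu
    exact (not_eq_of_ne_top (Ne.symm this)).symm
  rw [hwk] at this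
  cases h : t k <;> simp [h] at this

theorem upClosed_of_fixed {c : V → Bool} (hP : ∀ q ∈ A, EqOn q c P) (hc : EqOn (f c) c K) : UpClosed f t A P K T c := by
  intro q hq k hk _ h
  rw [glue_eq_right (hP q hq)] at h
  rw [← hc hk, h]

variable [DecidableEq V]

theorem IsTrapSet.update_mem (hA : IsTrapSet (asyncGraph f) A) {x : V → Bool} (hx : x ∈ A) {k : V}
    (hk : f x k ≠ x k) : Function.update x k (f x k) ∈ A := by
  apply hA x hx
  refine ⟨k, hk, ?_⟩
  rw [not_eq_of_ne_top hk.symm]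

theorem asyncGraph_iff {x y : V → Bool} :
    asyncGraph f x y ↔ ∃ i, f x i ≠ x i ∧ y = Function.update x i (f x i) := by
  constructor <;> rintro ⟨i, h, rfl⟩ <;> exact ⟨i, h, by rw [not_eq_of_ne_top h.symm]⟩

/-- The moves of the path inside `P` can be replayed from `x`, because they depend on `P` only; the
other moves are skipped. -/
theorem IsTrapSet.glue_mem (hA : IsTrapSet (asyncGraph f) A) (hP : Autonomous f P)
    {x c d : V → Bool} (hx : x ∈ A) (hcd : Relation.ReflTransGen (asyncGraph f) c d)
    (hc : EqOn c x P) : glue P d x ∈ A := by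
  induction hcd with
  | refl => rwa [glue_eq_right hc]
  | @tail b d _ hbd ih =>
    obtain ⟨i, hi, rfl⟩ := asyncGraph_iff.1 hbd
    by_cases hiP : i ∈ P
    · have hf : f (glue P b x) i = f b i := hP i hiP _ _ fun k hk => glue_of_mem hk
      have hg : glue P b x i = b i := glue_of_mem hiP
      have := hA.update_mem ih (k := i) (by rwa [hf, hg])
      convert this using 1
      funext k
      by_cases hk : k = i
      · subst hk
        simp [glue_of_mem hiP, hf]
      · by_cases hkP : k ∈ P
        · simp [glue_of_mem hkP, hk]
        · simp [glue_of_notMem hkP, hk]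
    · rwa [glue_congr_left (q' := b)]
      intro k hk
      rw [Function.update_of_ne]
      rintro rfl
      exact hiP hk

theorem IsAttractor.glue_mem (hA : IsAttractor (asyncGraph f) A) (hP : Autonomous f P)
    {a b : V → Bool} (ha : a ∈ A) (hb : b ∈ A) : glue P b a ∈ A :=
  hA.1.2.glue_mem hP ha (hA.reach ha hb) fun _ _ => rfl

/-- Attractors that meet on `P` share their `P`-parts, and every `P`-part combines with every state
off `P`. -/
theorem IsAttractor.glue_mem' (hA : IsAttractor (asyncGraph f) A)
    (hB : IsAttractor (asyncGraph f) B) (hP : Autonomous f P) {a b : V → Bool} (ha : a ∈ A)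
    (hb : b ∈ B) (hab : EqOn a b P) {a' b' : V → Bool} (ha' : a' ∈ A) (hb' : b' ∈ B) :
    glue P b' a' ∈ A := by
  have h : glue P b' a ∈ A := hA.1.2.glue_mem hP ha (hB.reach hb hb') hab.symm
  have := hA.glue_mem hP ha' h
  rwa [glue_congr_left (q' := b')] at this
  exact fun k hk => glue_of_mem hk

theorem UpClosed.congr (hA : IsAttractor (asyncGraph f) A)
    (hB : IsAttractor (asyncGraph f) B) (hP : Autonomous f P) {a b : V → Bool} (ha : a ∈ A)
    (hb : b ∈ B) (hab : EqOn a b P) {c : V → Bool} (hc : UpClosed f t A P K T c) :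
    UpClosed f t B P K T c := by
  intro q hq k hk hkT h
  refine hc _ (hA.glue_mem' hB hP ha hb hab ha hq) k hk hkT ?_
  rwa [glue_congr_left (q' := q)]
  exact fun k hk => glue_of_mem hk

/-- The states of `A` below `c` form a trap set: a move above `c` off `T` would, by monotonicity, be
a possible upward move of `c`, and on `T` the state `c` is already at the top. -/
theorem IsAttractor.below_of_upClosed (hA : IsAttractor (asyncGraph f) A)
    (hm : MonoOff f t P K T) {c : V → Bool} (hc : UpClosed f t A P K T c)
    (hcT : EqOn c t T) (hPK : Disjoint P K) {x : V → Bool} (hx : x ∈ A) (hxc : Below t K x c)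
    {y : V → Bool} (hy : y ∈ A) : Below t K y c := by
  refine (hA.eq_of_trap (X := {y | y ∈ A ∧ Below t K y c}) ?_ hx ⟨hx, hxc⟩ hy).2
  rintro x ⟨hx, hxc⟩ y hxy
  refine ⟨hA.1.2 x hx y hxy, ?_⟩
  obtain ⟨i, hi, rfl⟩ := asyncGraph_iff.1 hxy
  intro k hk h
  by_cases hki : k = i
  · subst hki
    by_cases hkT : k ∈ T
    · exact hcT hkT
    · rw [Function.update_self] at h
      refine hc x hx k hk hkT (hm k hk hkT x _ (fun j hj => (glue_of_mem hj).symm) ?_ h)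
      intro j hj hxj
      rw [glue_of_notMem (fun hjP => hPK.ne_of_mem hjP hj rfl)]
      exact hxc j hj hxj
  · rw [Function.update_of_ne hki] at h
    exact hxc k hk h

/-- Maximise the height over the states of `A` with the given values on `T`. A possible upward move
for some `P`-part `q` could be made inside `A`, since glueing `q` stays in `A` and does not affect
`K`. -/
theorem IsAttractor.exists_upClosed [Finite V] (hA : IsAttractor (asyncGraph f) A)
    (hP : Autonomous f P) (t : V → Bool) (hPK : Disjoint P K) (hT : T ⊆ K) {a : V → Bool}
    (ha : a ∈ A) : ∃ u ∈ A, EqOn u a T ∧ UpClosed f t A P K T u := by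
  obtain ⟨u, ⟨huA, huT⟩, hu⟩ := Set.exists_max_image {u | u ∈ A ∧ EqOn u a T} (height t K)
    (Set.toFinite _) ⟨a, ha, fun _ _ => rfl⟩
  refine ⟨u, huA, huT, fun q hq k hk hkT h => ?_⟩
  by_contra hne
  have hnP : ∀ {j}, j ∈ K → j ∉ P := fun hj hjP => hPK.ne_of_mem hjP hj rfl
  have hg : glue P q u k = u k := glue_of_notMem (hnP hk)
  have hmem := hA.1.2.update_mem (hA.glue_mem hP huA hq) (k := k) (by rw [h, hg]; exact Ne.symm hne)
  refine absurd (hu _ ⟨hmem, ?_⟩) (not_le.2 (height_lt (k := k) ?_ hk hne ?_))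
  · intro j hj
    rw [Function.update_of_ne (by rintro rfl; exact hkT hj), glue_of_notMem (hnP (hT hj)), huT hj]
  · intro j hj huj
    by_cases hjk : j = k
    · subst hjk; rw [Function.update_self, h]
    · rw [Function.update_of_ne hjk, glue_of_notMem (hnP hj), huj]
  · rw [Function.update_self, h]

/-- A set of configurations on which each component in `P` is constant. -/
def ConstOn (A : Set (V → Bool)) (P : Set V) : Prop := ∀ x ∈ A, ∀ y ∈ A, EqOn x y P

/-- Among the states of `A` where nothing off `T` can move up, take one of least height. A move off
`T` would go down and, by monotonicity, give a lower state of the same kind; a move on `T`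
contradicts `hcT`. Once fixed on `K`, the attractor keeps this value. -/
theorem IsAttractor.exists_fixed_on [Finite V] (hA : IsAttractor (asyncGraph f) A)
    (hP : Autonomous f P) (hPK : Disjoint P K) (hT : T ⊆ K) (hm : MonoOff f t P K T)
    (hcP : ConstOn A P) (hcT : ConstOn A T) : ∃ x ∈ A, EqOn (f x) x K ∧ ConstOn A K := by
  obtain ⟨a, ha⟩ := hA.1.1
  obtain ⟨u, huA, -, hu⟩ := hA.exists_upClosed hP t hPK hT ha
  obtain ⟨x, ⟨hxA, hx⟩, hmin⟩ := Set.exists_min_image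
    {x | x ∈ A ∧ ∀ k ∈ K, k ∉ T → f x k = t k → x k = t k} (height t K)
    (Set.toFinite _) ⟨u, huA, fun k hk hkT h => hu u huA k hk hkT (by
      rwa [glue_eq_right fun _ _ => rfl])⟩
  have hfix : EqOn (f x) x K := by
    intro k hk
    by_contra hne
    have hmem := hA.1.2.update_mem hxA hne
    by_cases hkT : k ∈ T
    · have := hcT _ hmem _ hxA hkT
      rw [Function.update_self] at this
      exact hne this
    have hxk : x k = t k := by
      have := hx k hk hkT
      revert this hne
      cases x k <;> cases f x k <;> cases t k <;> simp
    have hbel : Below t K (Function.update x k (f x k)) x := by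
      intro j hj h
      by_cases hjk : j = k
      · rw [hjk, hxk]
      · rwa [Function.update_of_ne hjk] at h
    refine absurd (hmin _ ⟨hmem, fun j hj hjT h => ?_⟩) (not_le.2 (height_lt hbel hk ?_ hxk))
    · have h' := hm j hj hjT _ _ (hcP _ hmem _ hxA) hbel h
      by_cases hjk : j = k
      · subst hjk
        rwa [Function.update_self]
      · rw [Function.update_of_ne hjk]
        exact hx j hj hjT h'
    · rw [Function.update_self, ← hxk]
      exact hne
  refine ⟨x, hxA, hfix, ?_⟩
  have key : ∀ y ∈ A, EqOn y x K := by
    intro y hy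
    refine (hA.eq_of_trap (X := {y | y ∈ A ∧ EqOn y x K}) ?_ hxA ⟨hxA, fun _ _ => rfl⟩ hy).2
    rintro y ⟨hy, hyx⟩ z hyz
    have hz := hA.1.2 y hy z hyz
    refine ⟨hz, ?_⟩
    obtain ⟨i, hi, rfl⟩ := asyncGraph_iff.1 hyz
    intro k hk
    by_cases hki : k = i
    · subst hki
      by_cases hkT : k ∈ T
      · exact hcT _ hz _ hxA hkT
      · rw [Function.update_self, hm.congr hk hkT (hcP _ hy _ hxA) hyx, hfix hk]
    · rw [Function.update_of_ne hki, hyx hk]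
  exact fun y hy z hz k hk => (key y hy hk).trans (key z hz hk).symm

theorem IsAttractor.exists_top [Finite V] (hA : IsAttractor (asyncGraph f) A)
    (hP : Autonomous f P) (hPK : Disjoint P K) (hT : T ⊆ K) (hm : MonoOff f t P K T)
    (ht : ∃ x ∈ A, EqOn x t T) :
    ∃ u ∈ A, EqOn u t T ∧ UpClosed f t A P K T u ∧ ∀ a ∈ A, Below t K a u := by
  obtain ⟨x, hx, hxt⟩ := ht
  obtain ⟨u, hu, hux, huc⟩ := hA.exists_upClosed hP t hPK hT hx
  exact ⟨u, hu, hux.trans hxt, huc,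
    fun a ha => hA.below_of_upClosed hm huc (hux.trans hxt) hPK hu (below_refl _ _ _) ha⟩

/-- Attractors whose hulls meet and that agree somewhere on `P` have the same top on `K`. -/
theorem exists_eqOn_of_monoOff [Finite V] (hA : IsAttractor (asyncGraph f) A)
    (hB : IsAttractor (asyncGraph f) B) (hP : Autonomous f P) (hPK : Disjoint P K) (hT : T ⊆ K)
    (hm : MonoOff f t P K T) (hm' : MonoOff f (fun k => !t k) P K T)
    {a b : V → Bool} (ha : a ∈ A) (hb : b ∈ B) (hab : EqOn a b P)
    {w : V → Bool} (hwA : w ∈ subspaceHull A) (hwB : w ∈ subspaceHull B)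
    (hA₁ : ∃ x ∈ A, EqOn x t T) (hB₁ : ∃ x ∈ B, EqOn x t T)
    (hA₀ : ∃ x ∈ A, EqOn x (fun k => !t k) T) (hB₀ : ∃ x ∈ B, EqOn x (fun k => !t k) T) :
    ∃ x ∈ A, ∃ y ∈ B, EqOn x y K := by
  obtain ⟨u, hu, hut, huc, hle⟩ := hA.exists_top hP hPK hT hm hA₁
  obtain ⟨v, hv, hvt, hvc, hle'⟩ := hB.exists_top hP hPK hT hm hB₁
  obtain ⟨l, hl, -, -, hge⟩ := hA.exists_top hP hPK hT hm' hA₀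
  obtain ⟨m, hm₁, -, -, hge'⟩ := hB.exists_top hP hPK hT hm' hB₀
  refine ⟨u, hu, v, hv, Below.antisymm (t := t) ?_ ?_⟩
  -- On `K`, `l ≤ w ≤ v`. The state `v` is also up-closed for `A`, so it bounds all of `A`, in
  -- particular `u`.
  · exact hA.below_of_upClosed hm (hvc.congr hB hA hP hb ha hab.symm) hvt hPK hl
      ((mem_subspaceHull_below hwA hge).flip.trans (mem_subspaceHull_below hwB hle')) hu
  · exact hB.below_of_upClosed hm (huc.congr hA hB hP ha hb hab) hut hPK hm₁
      ((mem_subspaceHull_below hwB hge').flip.trans (mem_subspaceHull_below hwA hle)) hv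

/-- Let `l` and `v` be the least and greatest states of `B` on `K`. Then `l ≤ w = x`, and the fixed
state `x` is a barrier for `B`, so `v ≤ x`; conversely `x = w ≤ v`. -/
theorem exists_eqOn_of_fixed [Finite V] (hB : IsAttractor (asyncGraph f) B)
    (hP : Autonomous f P) (hPK : Disjoint P K) (hT : T ⊆ K)
    (hm : MonoOff f t P K T) (hm' : MonoOff f (fun k => !t k) P K T) {x : V → Bool}
    (hfix : EqOn (f x) x K) (hPx : ∀ q ∈ B, EqOn q x P) (hxt : EqOn x t T)
    (hxB : ∃ w ∈ subspaceHull B, EqOn x w K)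
    (hB₁ : ∃ y ∈ B, EqOn y t T) (hB₀ : ∃ y ∈ B, EqOn y (fun k => !t k) T) :
    ∃ y ∈ B, EqOn x y K := by
  obtain ⟨w, hw, hxw⟩ := hxB
  obtain ⟨v, hv, -, -, hle⟩ := hB.exists_top hP hPK hT hm hB₁
  obtain ⟨l, hl, -, -, hge⟩ := hB.exists_top hP hPK hT hm' hB₀
  refine ⟨v, hv, Below.antisymm (t := t) ?_ ?_⟩
  · exact fun k hk h => mem_subspaceHull_below hw hle k hk (by rw [← hxw hk, h])
  · refine hB.below_of_upClosed hm (upClosed_of_fixed hPx hfix) hxt hPK hl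
      (fun k hk h => ?_) hv
    rw [hxw hk]
    exact (mem_subspaceHull_below hw hge).flip k hk h

end BooleanNetwork

namespace SignedDigraph

open Set

variable {V : Type*}

/-- The arcs of `G` with both ends in `K`. -/
def arcsOn (G : SignedDigraph V) (K : Set V) : Set (V × V × ℤˣ) :=
  {a | a ∈ G.arcs ∧ a.1 ∈ K ∧ a.2.1 ∈ K}

theorem IsNegativeCycle.mono {E F : Set (V × V × ℤˣ)} {C : Finset (V × V × ℤˣ)}
    (h : (SignedDigraph.mk E).IsNegativeCycle C) (hEF : E ⊆ F) :
    (SignedDigraph.mk F).IsNegativeCycle C :=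
  ⟨⟨h.1.1.trans hEF, h.1.2⟩, h.2⟩

theorem arcsOn_mono (G : SignedDigraph V) {K L : Set V} (h : K ⊆ L) : G.arcsOn K ⊆ G.arcsOn L :=
  fun _ ha => ⟨ha.1, h ha.2.1, h ha.2.2⟩

theorem IsNegativeCycle.exists_mem {G : SignedDigraph V} {C : Finset (V × V × ℤˣ)}
    (h : G.IsNegativeCycle C) : ∃ a, a ∈ C := by
  obtain ⟨⟨-, n, v, s, -, hC⟩, -⟩ := h
  refine ⟨(v 0, v (0 + 1), s 0), Finset.mem_coe.1 ?_⟩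
  rw [hC]
  exact ⟨0, rfl⟩

/-- If `G` has at most one negative cycle and is strong on `K`, then there is a potential for the
arcs within `K`, except those with head in a set `T` that has at most one element, and is empty
if there is no negative cycle within `K`. -/
theorem HasAtMostOneNegativeCycle.exists_potential {G : SignedDigraph V}
    (hG : G.HasAtMostOneNegativeCycle) {K : Set V}
    (hK : ∀ u ∈ K, ∀ v ∈ K, ∃ e, SignedWalk (G.arcsOn K) u v e) :
    ∃ T ⊆ K, T.Subsingleton ∧ (T.Nonempty → ∃ C, (mk (G.arcsOn K)).IsNegativeCycle C) ∧
      ∃ ρ : V → ℤˣ, ∀ j k s, (j, k, s) ∈ G.arcsOn K → k ∉ T → s = ρ j * ρ k := by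
  have hEK : ∀ j k s, (j, k, s) ∈ G.arcsOn K → j ∈ K ∧ k ∈ K := fun j k s h => h.2
  by_cases h : ∃ C, (mk (G.arcsOn K)).IsNegativeCycle C
  · obtain ⟨C, hC⟩ := h
    obtain ⟨b, hb, ρ, hρ⟩ := exists_potential_diff_singleton_of_unique hEK hK hC fun D hD =>
      hG (hD.mono fun a ha => ha.1) (hC.mono fun a ha => ha.1)
    -- Dropping the arc `b` amounts to giving up monotonicity at its head.
    refine ⟨{b.2.1}, by simpa using hb.2.2, Set.subsingleton_singleton, fun _ => ⟨C, hC⟩, ρ,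
      fun j k s h hk => hρ j k s ⟨h, ?_⟩⟩
    rintro rfl
    exact hk rfl
  · push Not at h
    obtain ⟨ρ, hρ⟩ := exists_potential_of_strong hEK hK h
    exact ⟨∅, Set.empty_subset _, Set.subsingleton_empty, fun h => absurd h Set.not_nonempty_empty,
      ρ, fun j k s h _ => hρ j k s h⟩

end SignedDigraph

/-! ### From interaction graphs to monotonicity -/

namespace BooleanNetwork

open Set SignedDigraph

variable {V : Type*}

theorem mem_subspaceHull_iff {A : Set (V → Bool)} {w : V → Bool} :
    w ∈ subspaceHull A ↔ ∀ k c, (∀ a ∈ A, a k = c) → w k = c := by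
  refine ⟨fun h k c => mem_subspaceHull_apply h, fun h => ?_⟩
  rintro _ ⟨⟨I, c, rfl⟩, hA⟩ i hi
  exact h i (c i) fun a ha => hA ha i hi

theorem subset_subspaceHull (A : Set (V → Bool)) : A ⊆ subspaceHull A :=
  fun _ ha _ hY => hY.2 ha

theorem isSubspace_subspaceHull {A : Set (V → Bool)} (hA : A.Nonempty) :
    IsSubspace (subspaceHull A) := by
  obtain ⟨a, ha⟩ := hA
  refine ⟨{k | ∀ b ∈ A, b k = a k}, a, ?_⟩
  ext w
  rw [mem_subspaceHull_iff]
  refine ⟨fun h i hi => h i _ hi, fun h k c hc => ?_⟩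
  rw [← hc a ha]
  exact h k fun b hb => by rw [hc b hb, hc a ha]

theorem subspaceHull_eq_trapSpaceHull {Γ : (V → Bool) → (V → Bool) → Prop} {A : Set (V → Bool)}
    (hA : A.Nonempty) (h : IsTrapSet Γ (subspaceHull A)) :
    subspaceHull A = trapSpaceHull Γ A :=
  Set.Subset.antisymm (fun _ hx Y hY => hx Y ⟨hY.1.1, hY.2⟩)
    (Set.sInter_subset_of_mem ⟨⟨isSubspace_subspaceHull hA, h⟩, subset_subspaceHull A⟩)

theorem ConstOn.eqOn_of_mem_subspaceHull {A : Set (V → Bool)} {K : Set V} (hA : ConstOn A K)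
    {x w : V → Bool} (hx : x ∈ A) (hw : w ∈ subspaceHull A) : EqOn x w K :=
  fun _ hk => (mem_subspaceHull_apply hw fun a ha => hA a ha x hx hk).symm

/-- On a set with at most one element, a non-constant set of configurations takes all values. -/
theorem exists_eqOn_of_not_constOn {A : Set (V → Bool)} {T : Set V} (hT : T.Subsingleton)
    (hA : ¬ ConstOn A T) (t : V → Bool) : ∃ x ∈ A, EqOn x t T := by
  unfold ConstOn at hA
  push Not at hA
  obtain ⟨x, hx, y, hy, h⟩ := hA
  by_contra hcon
  push Not at hcon
  refine h fun i hi => ?_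
  have key : ∀ z ∈ A, z i ≠ t i := fun z hz h => hcon z hz fun j hj => by rwa [hT hj hi]
  have h₁ := key x hx
  have h₂ := key y hy
  revert h₁ h₂
  cases x i <;> cases y i <;> cases t i <;> simp

/-- `P` is closed under taking in-neighbours. -/
def PredClosed (G : SignedDigraph V) (P : Set V) : Prop :=
  ∀ j k s, (j, k, s) ∈ G.arcs → k ∈ P → j ∈ P

/-- The configuration of top values given by a potential, with a prescribed value on a set with at
most one element. -/
theorem exists_top_of_potential (ρ : V → ℤˣ) {T : Set V} (hT : T.Subsingleton) (x : V → Bool) :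
    ∃ t : V → Bool, (∀ j k, t j = t k ↔ ρ j = ρ k) ∧ EqOn x t T := by
  have h₀ : ∀ j k, decide (ρ j = 1) = decide (ρ k = 1) ↔ ρ j = ρ k := by
    intro j k
    rcases sign_eq_or (ρ j) with h₁ | h₁ <;> rcases sign_eq_or (ρ k) with h₂ | h₂ <;>
      rw [h₁, h₂] <;> decide
  by_cases h : EqOn x (fun k => decide (ρ k = 1)) T
  · exact ⟨_, h₀, h⟩
  · refine ⟨fun k => !decide (ρ k = 1), fun j k => by rw [← h₀ j k]; simp, fun i hi => ?_⟩
    by_contra hne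
    refine h fun j hj => ?_
    rw [hT hj hi]
    revert hne
    cases x i <;> simp

/-- Take a minimal predecessor-closed `Q` strictly containing `P`. For `v ∈ Q \ P`, the set `P`
together with the vertices that reach `v` within `Q \ P` is predecessor-closed, so it is all of `Q`.
-/
theorem exists_strong_part {G : SignedDigraph V} [Finite V] {P : Set V} (hP : PredClosed G P)
    (hne : P ≠ univ) : ∃ K : Set V, K.Nonempty ∧ Disjoint P K ∧ PredClosed G (P ∪ K) ∧
      ∀ u ∈ K, ∀ v ∈ K, ∃ e, SignedWalk (G.arcsOn K) u v e := by
  obtain ⟨Q, ⟨hQ, hPQ⟩, hmin⟩ := Set.exists_min_image {Q | PredClosed G Q ∧ P ⊂ Q} Set.ncard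
    (Set.toFinite _) ⟨univ, fun _ _ _ _ _ => trivial, Set.ssubset_univ_iff.2 hne⟩
  have hU : P ∪ Q \ P = Q := Set.union_sdiff_cancel hPQ.1
  refine ⟨Q \ P, Set.nonempty_of_ssubset hPQ, disjoint_sdiff_right, hU.symm ▸ hQ,
    fun u hu v hv => ?_⟩
  set R : Set V := P ∪ {u | u ∈ Q \ P ∧ ∃ e, SignedWalk (G.arcsOn (Q \ P)) u v e}
  have hRQ : R ⊆ Q := by
    rintro w (hw | hw)
    exacts [hPQ.1 hw, hw.1.1]
  have hR : PredClosed G R := by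
    rintro j k s h (hk | ⟨hk, e, he⟩)
    · exact .inl (hP j k s h hk)
    · by_cases hj : j ∈ P
      · exact .inl hj
      · have hj' : j ∈ Q \ P := ⟨hQ j k s h hk.1, hj⟩
        exact .inr ⟨hj', _, he.head ⟨h, hj', hk⟩⟩
  have hPR : P ⊂ R := ⟨Set.subset_union_left, fun h => hv.2 (h (.inr ⟨hv, 1, .refl⟩))⟩
  have hRQ' : R = Q := Set.eq_of_subset_of_ncard_le hRQ (hmin R ⟨hR, hPR⟩) (Set.toFinite _)
  have : u ∈ R := hRQ' ▸ hu.1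
  exact (this.resolve_left hu.2).2

variable [DecidableEq V] {f : (V → Bool) → (V → Bool)}

/-- If `f k` differs at `x` and `y`, then some arc with head `k` accounts for it. -/
theorem exists_arc_of_ne [Finite V] {x y : V → Bool} {k : V} (h : f x k ≠ f y k) :
    ∃ j, x j ≠ y j ∧ (j, k, if y j = f y k then 1 else -1) ∈ (interactionGraph f).arcs := by
  induction hn : {j | x j ≠ y j}.ncard using Nat.strong_induction_on generalizing x with
  | _ n ih =>
  have hxy : x ≠ y := fun h' => h (by rw [h'])
  -- Move `x` towards `y` one component at a time, until `f k` takes its value at `y`.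
  obtain ⟨j, hj⟩ := Function.ne_iff.1 hxy
  set z := Function.update x j (y j) with hz
  have hzj : z j = y j := Function.update_self ..
  have hzi : ∀ i, i ≠ j → z i = x i := fun i hi => Function.update_of_ne hi ..
  by_cases hfz : f z k = f y k
  · refine ⟨j, hj, ?_⟩
    have hx : Function.update z j (x j) = x := by simp [z]
    have hfx : f x k = !f y k := (not_eq_of_ne_top h.symm).symm
    cases hyj : y j
    · have hxj : x j = true := by simpa [hyj] using hj
      refine ⟨z, hzj.trans hyj, ?_⟩
      rw [hxj] at hx
      simp only [hx, hfz, hfx]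
      cases f y k <;> simp
    · have hxj : x j = false := by simpa [hyj] using hj
      refine ⟨x, hxj, ?_⟩
      rw [hyj] at hz
      simp only [← hz, hfz, hfx]
      cases f y k <;> simp
  · have hlt : {i | z i ≠ y i}.ncard < n := by
      rw [← hn]
      refine Set.ncard_lt_ncard ⟨fun i hi hxi => hi ?_, fun hs => hs hj hzj⟩ (Set.toFinite _)
      by_cases hij : i = j
      · rw [hij, hzj]
      · rw [hzi i hij, hxi]
    obtain ⟨i, hi, ha⟩ := ih _ hlt hfz rfl
    refine ⟨i, ?_, ha⟩
    rwa [← hzi i]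
    rintro rfl
    exact hi hzj

theorem PredClosed.autonomous [Finite V] {P : Set V} (hP : PredClosed (interactionGraph f) P) :
    Autonomous f P := by
  intro k hk x y hxy
  by_contra h
  obtain ⟨j, hj, ha⟩ := exists_arc_of_ne h
  exact hj (hxy (hP _ _ _ ha hk))

/-- Relative to the top values `t`, each arc within `K` with head off `T` is positive. A failure of
monotonicity would need a negative one, since `P` is fixed and no other arcs enter `K`. -/
theorem monoOff_of_potential [Finite V] {P K T : Set V} {t : V → Bool} {ρ : V → ℤˣ}
    (hPK : PredClosed (interactionGraph f) (P ∪ K))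
    (hρ : ∀ j k s, (j, k, s) ∈ (interactionGraph f).arcsOn K → k ∉ T → s = ρ j * ρ k)
    (ht : ∀ j k, t j = t k ↔ ρ j = ρ k) : MonoOff f t P K T := by
  intro k hk hkT x y hxy hle hx
  by_contra hy
  obtain ⟨j, hj, ha⟩ := exists_arc_of_ne (f := f) (x := x) (y := y) (k := k) (by rw [hx]; exact Ne.symm hy)
  have hjK : j ∈ K := (hPK _ _ _ ha (Or.inr hk)).resolve_left fun h => hj (hxy h)
  have hs := hρ _ _ _ ⟨ha, hjK, hk⟩ hkT
  have hxt : x j ≠ t j := fun h => hj (h.trans (hle j hjK h).symm)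
  have hyt : y j = t j := by
    revert hj hxt
    cases x j <;> cases y j <;> cases t j <;> simp
  have htjk := ht j k
  rw [hyt] at hs
  rcases sign_eq_or (ρ j) with h₁ | h₁ <;> rcases sign_eq_or (ρ k) with h₂ | h₂ <;>
    rw [h₁, h₂] at htjk hs <;> revert htjk hs hy <;>
    cases t j <;> cases t k <;> cases f y k <;> decide

/-! ### Separation: adding strong parts one by one -/

/-- The attractors `A` and `B` agree on `P`, and are constant there if there is no negative cycle
within `P`. -/
structure AgreeOn (f : (V → Bool) → (V → Bool)) (A B : Set (V → Bool)) (P : Set V) : Prop where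
  predClosed : PredClosed (interactionGraph f) P
  exists_eqOn : ∃ a ∈ A, ∃ b ∈ B, EqOn a b P
  constOn : (∀ C, ¬ (SignedDigraph.mk ((interactionGraph f).arcsOn P)).IsNegativeCycle C) →
    ConstOn A P ∧ ConstOn B P

theorem AgreeOn.union [Finite V] (hG : (interactionGraph f).HasAtMostOneNegativeCycle)
    {A B : Set (V → Bool)} (hA : IsAttractor (asyncGraph f) A) (hB : IsAttractor (asyncGraph f) B)
    {w : V → Bool} (hwA : w ∈ subspaceHull A) (hwB : w ∈ subspaceHull B) {P K : Set V}
    (h : AgreeOn f A B P) (hPK : Disjoint P K) (hPK' : PredClosed (interactionGraph f) (P ∪ K))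
    (hK : ∀ u ∈ K, ∀ v ∈ K, ∃ e, SignedWalk ((interactionGraph f).arcsOn K) u v e) :
    AgreeOn f A B (P ∪ K) := by
  obtain ⟨a, ha, b, hb, hab⟩ := h.exists_eqOn
  have hP := h.predClosed.autonomous
  obtain ⟨T, hTK, hT, hTneg, ρ, hρ⟩ := hG.exists_potential hK
  have mono : ∀ t : V → Bool, (∀ j k, t j = t k ↔ ρ j = ρ k) →
      MonoOff f t P K T ∧ MonoOff f (fun k => !t k) P K T := fun t ht =>
    ⟨monoOff_of_potential hPK' hρ ht, monoOff_of_potential hPK' hρ (by simpa using ht)⟩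
  have constK : ∀ {A}, IsAttractor (asyncGraph f) A → ConstOn A P → ConstOn A T →
      ∃ x ∈ A, EqOn (f x) x K ∧ ConstOn A K := by
    intro A hA hAP hAT
    obtain ⟨t, ht, -⟩ := exists_top_of_potential ρ hT w
    exact hA.exists_fixed_on hP hPK hTK (mono t ht).1 hAP hAT
  have constOn_union : ∀ {A}, ConstOn A P → ConstOn A K → ConstOn A (P ∪ K) :=
    fun h₁ h₂ x hx y hy => (h₁ x hx y hy).union (h₂ x hx y hy)
  -- One attractor is frozen on `K`, the other varies on `T`. The orientation `t` is chosen to match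
  -- the frozen state on `T`.
  have mixed : ∀ {A B}, IsAttractor (asyncGraph f) A → IsAttractor (asyncGraph f) B →
      w ∈ subspaceHull A → w ∈ subspaceHull B → ConstOn A P → ConstOn B P →
      (∃ a ∈ A, ∃ b ∈ B, EqOn a b P) → ConstOn A T → ¬ ConstOn B T →
      ∃ x ∈ A, ∃ y ∈ B, EqOn x y K := by
    rintro A B hA hB hwA hwB hAP hBP ⟨a, ha, b, hb, hab⟩ hAT hBT
    obtain ⟨x, hx, hfix, hAK⟩ := constK hA hAP hAT
    obtain ⟨t, ht, hxt⟩ := exists_top_of_potential ρ hT x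
    exact ⟨x, hx, exists_eqOn_of_fixed hB hP hPK hTK (mono t ht).1 (mono t ht).2 hfix
      (fun q hq => ((hBP q hq b hb).trans hab.symm).trans (hAP a ha x hx)) hxt
      ⟨w, hwB, hAK.eqOn_of_mem_subspaceHull hx hwA⟩
      (exists_eqOn_of_not_constOn hT hBT _) (exists_eqOn_of_not_constOn hT hBT _)⟩
  have general : (∀ t, ∃ x ∈ A, EqOn x t T) → (∀ t, ∃ x ∈ B, EqOn x t T) →
      ∃ x ∈ A, ∃ y ∈ B, EqOn x y K := by
    intro hAt hBt
    obtain ⟨t, ht, -⟩ := exists_top_of_potential ρ hT w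
    exact exists_eqOn_of_monoOff hA hB hP hPK hTK (mono t ht).1 (mono t ht).2 ha hb hab hwA hwB
      (hAt _) (hBt _) (hAt _) (hBt _)
  have hmono : (interactionGraph f).arcsOn P ⊆ (interactionGraph f).arcsOn (P ∪ K) :=
    arcsOn_mono _ Set.subset_union_left
  refine ⟨hPK', ?_, fun hno => ?_⟩
  · suffices ∃ x ∈ A, ∃ y ∈ B, EqOn x y K by
      obtain ⟨x, hx, y, hy, hxy⟩ := this
      refine ⟨_, hA.glue_mem' hB hP ha hb hab hx hy, y, hy, ?_⟩
      refine EqOn.union (fun k hk => glue_of_mem hk) fun k hk => ?_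
      rw [glue_of_notMem fun hkP => hPK.ne_of_mem hkP hk rfl, hxy hk]
    rcases T.eq_empty_or_nonempty with rfl | hTne
    · exact general (fun _ => ⟨a, ha, Set.eqOn_empty _ _⟩) fun _ => ⟨b, hb, Set.eqOn_empty _ _⟩
    obtain ⟨C, hC⟩ := hTneg hTne
    -- The unique negative cycle lies in `K`, so none lies in `P`, and both attractors are frozen
    -- there.
    obtain ⟨hAP, hBP⟩ := h.constOn fun D hD => by
      have := hG (hD.mono fun a ha => ha.1) (hC.mono fun a ha => ha.1)
      subst this
      obtain ⟨c, hc⟩ := hC.exists_mem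
      exact hPK.ne_of_mem (hD.1.1 hc).2.1 (hC.1.1 hc).2.1 rfl
    by_cases hAT : ConstOn A T <;> by_cases hBT : ConstOn B T
    · obtain ⟨x, hx, -, hAK⟩ := constK hA hAP hAT
      obtain ⟨y, hy, -, hBK⟩ := constK hB hBP hBT
      exact ⟨x, hx, y, hy, (hAK.eqOn_of_mem_subspaceHull hx hwA).trans
        (hBK.eqOn_of_mem_subspaceHull hy hwB).symm⟩
    · exact mixed hA hB hwA hwB hAP hBP ⟨a, ha, b, hb, hab⟩ hAT hBT
    · obtain ⟨y, hy, x, hx, hxy⟩ :=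
        mixed hB hA hwB hwA hBP hAP ⟨b, hb, a, ha, hab.symm⟩ hBT hAT
      exact ⟨x, hx, y, hy, hxy.symm⟩
    · exact general (exists_eqOn_of_not_constOn hT hAT) (exists_eqOn_of_not_constOn hT hBT)
  · obtain ⟨hAP, hBP⟩ := h.constOn fun C hC => hno C (hC.mono hmono)
    have hTe : T = ∅ := by
      rw [← Set.not_nonempty_iff_eq_empty]
      intro hTne
      obtain ⟨C, hC⟩ := hTneg hTne
      exact hno C (hC.mono (arcsOn_mono _ Set.subset_union_right))
    subst hTe
    obtain ⟨-, -, -, hAK⟩ := constK hA hAP fun _ _ _ _ => Set.eqOn_empty _ _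
    obtain ⟨-, -, -, hBK⟩ := constK hB hBP fun _ _ _ _ => Set.eqOn_empty _ _
    exact ⟨constOn_union hAP hAK, constOn_union hBP hBK⟩

theorem isSeparating_of_hasAtMostOneNegativeCycle [Finite V]
    (hG : (interactionGraph f).HasAtMostOneNegativeCycle) : IsSeparating (asyncGraph f) := by
  intro A B hA hB hne
  rw [Set.eq_empty_iff_forall_notMem]
  rintro w ⟨hwA, hwB⟩
  refine hne ?_
  obtain ⟨P, hP, hmax⟩ := Set.exists_max_image {P | AgreeOn f A B P} Set.ncard (Set.toFinite _) (by
    obtain ⟨a, ha⟩ := hA.1.1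
    obtain ⟨b, hb⟩ := hB.1.1
    exact ⟨∅, fun _ _ _ _ h => h, ⟨a, ha, b, hb, Set.eqOn_empty _ _⟩,
      fun _ => ⟨fun _ _ _ _ => Set.eqOn_empty _ _, fun _ _ _ _ => Set.eqOn_empty _ _⟩⟩)
  have hPu : P = univ := by
    by_contra hPu
    obtain ⟨K, hKne, hPK, hPK', hK⟩ := exists_strong_part hP.predClosed hPu
    refine absurd (hmax _ (hP.union hG hA hB hwA hwB hPK hPK' hK)) (not_le.2 ?_)
    refine Set.ncard_lt_ncard ⟨Set.subset_union_left, fun h => ?_⟩ (Set.toFinite _)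
    obtain ⟨k, hk⟩ := hKne
    exact hPK.ne_of_mem (h (.inr hk)) hk rfl
  obtain ⟨a, ha, b, hb, hab⟩ := hP.exists_eqOn
  rw [hPu, Set.eqOn_univ] at hab
  subst hab
  exact hA.eq_of_mem hB ha hb

/-! ### Trapping in the strongly connected case -/

theorem isTrapSet_subspaceHull [Finite V] (hG : (interactionGraph f).HasAtMostOneNegativeCycle)
    (hS : (interactionGraph f).IsStrong) {A : Set (V → Bool)}
    (hA : IsAttractor (asyncGraph f) A) : IsTrapSet (asyncGraph f) (subspaceHull A) := by
  have hK : ∀ u ∈ univ, ∀ v ∈ univ,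
      ∃ e, SignedWalk ((interactionGraph f).arcsOn univ) u v e := by
    intro u _ v hv
    clear hv
    induction hS u v with
    | refl => exact ⟨1, .refl⟩
    | tail _ h ih =>
      obtain ⟨e, he⟩ := ih
      obtain ⟨s, hs⟩ := h
      exact ⟨_, he.tail ⟨hs, trivial, trivial⟩⟩
  have hP : PredClosed (interactionGraph f) ∅ := fun _ _ _ _ h => h
  have hPK' : PredClosed (interactionGraph f) (∅ ∪ univ) := by
    rw [Set.empty_union]; exact fun _ _ _ _ _ => trivial
  have hPK : Disjoint (∅ : Set V) univ := Set.empty_disjoint _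
  obtain ⟨T, hTK, hT, -, ρ, hρ⟩ := hG.exists_potential hK
  obtain ⟨a, ha⟩ := hA.1.1
  obtain ⟨t, ht, -⟩ := exists_top_of_potential ρ hT a
  have hm : MonoOff f t ∅ univ T := monoOff_of_potential hPK' hρ ht
  have hm' : MonoOff f (fun k => !t k) ∅ univ T :=
    monoOff_of_potential hPK' hρ (by simpa using ht)
  intro x hx y hxy
  by_cases hconst : T.Nonempty ∧ ConstOn A T
  -- Here `A`, and hence its hull, is a single configuration.
  · obtain ⟨z, hz, -, hAK⟩ := hA.exists_fixed_on hP.autonomous hPK hTK hm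
      (fun _ _ _ _ => Set.eqOn_empty _ _) hconst.2
    have : z = x := (Set.eqOn_univ _ _).1 (hAK.eqOn_of_mem_subspaceHull hz hx)
    subst this
    exact subset_subspaceHull A (hA.1.2 z hz y hxy)
  have hall : ∀ t, ∃ x ∈ A, EqOn x t T := by
    intro t
    by_cases hAT : ConstOn A T
    · obtain rfl : T = ∅ := Set.not_nonempty_iff_eq_empty.1 fun h => hconst ⟨h, hAT⟩
      exact ⟨a, ha, Set.eqOn_empty _ _⟩
    · exact exists_eqOn_of_not_constOn hT hAT t
  -- The greatest state `u` of `A` lies above the whole hull. If `f x k` were at the top, so would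
  -- be `f u k` and then `u k`, contrary to `k` being constant on `A` at the other value. With `!t`
  -- this covers the other case.
  have key : ∀ {t : V → Bool}, MonoOff f t ∅ univ T → ∀ {k c}, (∀ a ∈ A, a k = c) → c ≠ t k →
      f x k ≠ t k := by
    intro t hm k c hc hct hfx
    have hkT : k ∉ T := by
      intro hkT
      obtain ⟨z, hz, hzt⟩ := hall t
      exact hct ((hc z hz).symm.trans (hzt hkT))
    obtain ⟨u, hu, -, huc, hle⟩ := hA.exists_top hP.autonomous hPK hTK hm (hall t)
    have := hm k trivial hkT x u (Set.eqOn_empty _ _) (mem_subspaceHull_below hx hle) hfx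
    refine hct ((hc u hu).symm.trans (huc u hu k trivial hkT ?_))
    rwa [glue_eq_right fun _ _ => rfl]
  obtain ⟨i, hi, rfl⟩ := asyncGraph_iff.1 hxy
  rw [mem_subspaceHull_iff] at hx ⊢
  intro k c hc
  by_cases hki : k = i
  · subst hki
    rw [Function.update_self]
    by_cases hct : c = t k
    · have := key hm' hc (by simp [hct])
      rw [hct]
      cases h₁ : f x k <;> cases h₂ : t k <;> simp_all
    · have := key hm hc hct
      revert this hct
      cases f x k <;> cases t k <;> cases c <;> simp
  · rw [Function.update_of_ne hki]
    exact hx k c hc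

end BooleanNetwork

theorem theorem5p1 {V : Type*} [Finite V] [DecidableEq V] (G : SignedDigraph V)
    (hG : G.HasAtMostOneNegativeCycle) :
    G.IsSeparating ∧ (G.IsStrong → G.IsTrapping) := by
  have hsep : G.IsSeparating := by
    rintro f rfl
    exact BooleanNetwork.isSeparating_of_hasAtMostOneNegativeCycle hG
  refine ⟨hsep, ?_⟩
  rintro hS f rfl
  exact ⟨hsep f rfl, fun A hA => BooleanNetwork.subspaceHull_eq_trapSpaceHull hA.1.1
    (BooleanNetwork.isTrapSet_subspaceHull hG hS hA)⟩
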